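/- Let $d$ be the Euclidean distance on $\mathbb R^2$. There exist a probability measure $\mu$ on $\mathbb R^2$ with $\mu(B)=1$, where $B$ is the closed unit ball centered at the origin, and centers $c_1,\dots,c_7\in\mathbb R^2$ such that (i) $\mu$ has a continuous density function with respect to Lebesgue measure; (ii) $\mu$ is invariant under rotations centered at the origin; (iii) every open set containing the origin has positive $\mu$-measure; (iv) $\min_{i\neq j} d(c_i,c_j)=2.2$; and such that with high probability the $k$-median linear program with $k=7$ does not achieve exact recovery in the stochastic ball model given by $\mu$ and $c_1,\dots,c_7$. The terms in the last clause mean the following. For $n\ge 1$ draw independent random vectors $v^{(i)}_\ell$, $i\in\{1,\dots,7\}$, $\ell\in\{1,\dots,n\}$, according to $\mu$, and let $P$ be the family of the $7n$ data points $x^{(i)}_\ell=c_i+v^{(i)}_\ell$ (almost surely distinct). The $k$-median linear program is $$\min \sum_{p,q\in P} d(p,q)z_{pq}\quad\text{s.t.}\quad \sum_{p\in P}z_{pq}=1\ \ \forall q\in P,\quad z_{pq}\le y_p\ \ \forall p,q\in P,\quad \sum_{p\in P}y_p=7,\quad y_p,z_{pq}\ge 0\ \ \forall p,q\in P.$$ It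 achieves exact recovery if it has a unique optimal solution $(y,z)$, all entries of this solution are in $\{0,1\}$, and $z_{pq}=1$ only if $p$ and $q$ are drawn from the same ball, i.e. $p=x^{(i)}_\ell$ and $q=x^{(i)}_{\ell'}$ for some $i,\ell,\ell'$. "With high probability" means that for every $\delta\in(0,1)$ there is $N$ such that for all $n>N$ the probability that exact recovery is not achieved is greater than $1-\delta$. -/

import Mathlib

open MeasureTheory

/-! The `k`-median problem on a finite family of points `x : ι → X`.
`y p` says how much `p` is opened as a center, `z p q` how much `q` is assigned to `p`. -/

namespace KMedian

/-- The objective function `∑_{p,q} d(p,q) z_{pq}`. -/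
noncomputable def cost {ι X : Type*} [Fintype ι] [MetricSpace X] (x : ι → X) (z : ι → ι → ℝ) : ℝ :=
  ∑ p, ∑ q, dist (x p) (x q) * z p q

/-- Feasibility for the linear programming relaxation (LP). -/
structure LPFeasible {ι : Type*} [Fintype ι] (k : ℕ) (y : ι → ℝ) (z : ι → ι → ℝ) : Prop where
  assigned : ∀ q, ∑ p, z p q = 1
  le_open : ∀ p q, z p q ≤ y p
  sum_open : ∑ p, y p = (k : ℝ)
  y_nonneg : ∀ p, 0 ≤ y p
  z_nonneg : ∀ p q, 0 ≤ z p q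

/-- Feasibility for the integer program (IP). -/
structure IPFeasible {ι : Type*} [Fintype ι] (k : ℕ) (y : ι → ℝ) (z : ι → ι → ℝ) : Prop where
  assigned : ∀ q, ∑ p, z p q = 1
  le_open : ∀ p q, z p q ≤ y p
  sum_open : ∑ p, y p = (k : ℝ)
  y_binary : ∀ p, y p = 0 ∨ y p = 1
  z_binary : ∀ p q, z p q = 0 ∨ z p q = 1

/-- `(y, z)` is an optimal solution to (LP). -/
def IsLPOptimal {ι X : Type*} [Fintype ι] [MetricSpace X] (k : ℕ) (x : ι → X)
    (y : ι → ℝ) (z : ι → ι → ℝ) : Prop :=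
  LPFeasible k y z ∧ ∀ y' z', LPFeasible k y' z' → cost x z ≤ cost x z'

/-- (LP) achieves exact recovery for the points `x (i, ℓ)`, where `x (i, ℓ)` is the `ℓ`-th point
drawn from ball `i`: it has a unique optimal solution, this solution is feasible to (IP), and it
assigns each point to a center that is drawn from the same ball. -/
def AchievesExactRecovery {X : Type*} [MetricSpace X] {k n : ℕ} (x : Fin k × Fin n → X) : Prop :=
  ∃ (y : Fin k × Fin n → ℝ) (z : Fin k × Fin n → Fin k × Fin n → ℝ),
    IsLPOptimal k x y z ∧
    (∀ y' z', IsLPOptimal k x y' z' → y' = y ∧ z' = z) ∧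
    IPFeasible k y z ∧
    ∀ p q, z p q = 1 → p.1 = q.1

end KMedian

/-! The stochastic ball model in `ℝ^m`. -/

namespace SBM

/-- `μ` is a probability measure living on the closed unit ball centered at the origin. -/
structure IsUnitBallProbability {m : ℕ} (μ : Measure (EuclideanSpace ℝ (Fin m))) : Prop where
  isProbability : IsProbabilityMeasure μ
  supported : μ (Metric.closedBall 0 1)ᶜ = 0

/-- The joint law of the `k * n` independent random vectors `v (i, ℓ)`, each drawn according
to `μ`. -/
noncomputable def sampleLaw {m : ℕ} (μ : Measure (EuclideanSpace ℝ (Fin m))) (k n : ℕ) :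
    Measure (Fin k × Fin n → EuclideanSpace ℝ (Fin m)) :=
  Measure.pi fun _ => μ

/-- The data points `c i + v (i, ℓ)`. -/
noncomputable def dataPoints {m k n : ℕ} (c : Fin k → EuclideanSpace ℝ (Fin m))
    (v : Fin k × Fin n → EuclideanSpace ℝ (Fin m)) :
    Fin k × Fin n → EuclideanSpace ℝ (Fin m) :=
  fun p => c p.1 + v p

/-- Invariance under rotations centered at the origin. All linear isometries are allowed (for
`m = 1` this is symmetry; for `m ≥ 2` it is equivalent to invariance under those of
determinant one). -/
def IsRotationInvariant {m : ℕ} (μ : Measure (EuclideanSpace ℝ (Fin m))) : Prop :=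
  ∀ A : EuclideanSpace ℝ (Fin m) ≃ₗᵢ[ℝ] EuclideanSpace ℝ (Fin m), μ.map A = μ

/-- Every open set containing the origin has positive measure. -/
def HasMassNearCenter {m : ℕ} (μ : Measure (EuclideanSpace ℝ (Fin m))) : Prop :=
  ∀ U : Set (EuclideanSpace ℝ (Fin m)), IsOpen U → 0 ∈ U → 0 < μ U

/-- `μ` has a continuous density function with respect to Lebesgue measure on `ℝ^m`. -/
def HasContinuousDensity {m : ℕ} (μ : Measure (EuclideanSpace ℝ (Fin m))) : Prop :=
  ∃ f : EuclideanSpace ℝ (Fin m) → ℝ, Continuous f ∧ (∀ x, 0 ≤ f x) ∧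
    μ = volume.withDensity fun x => ENNReal.ofReal (f x)

/-- The events `A n` happen with high probability: for every `δ ∈ (0,1)`, for all large `n`,
`Pr (A n) > 1 - δ`. The measurable set `E` makes this an inner-measure bound, so that it says
`Pr (A n) > 1 - δ` for measurable `A n` and is never weaker than that. -/
def WithHighProbability {Ω : ℕ → Type*} [∀ n, MeasurableSpace (Ω n)] (P : ∀ n, Measure (Ω n))
    (A : ∀ n, Set (Ω n)) : Prop :=
  ∀ δ : ℝ, 0 < δ → δ < 1 → ∃ N : ℕ, ∀ n : ℕ, N < n →
    ∃ E : Set (Ω n), MeasurableSet E ∧ E ⊆ A n ∧ ENNReal.ofReal (1 - δ) < P n E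

end SBM

/-!
Exact recovery forces the optimal solution to open one data point in each ball and to assign every
point to the center in its own ball. As the directions `v / ‖v‖` average to zero, the origin is
asymptotically a Fermat point of each ball: by the gradient inequality
`‖v‖ - ⟪v / ‖v‖, w⟫ ≤ ‖w - v‖`, no median inside a ball is cheaper than its center, up to `o(n)`.
Hence the cost is at least `7 n ∫ ‖v‖ - o(n)`, which is close to `7 n` if the mass of `μ`
concentrates near the unit circle.

For such a measure it is cheaper to leave the central ball of a cross of five balls without a
median, to give two medians to one of its neighbors, and to push the medians of the other three
neighbors slightly towards the central ball. Since the interiors of the balls lie in the support of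
the data, these medians are approximated by data points, so with high probability an assignment
across balls beats every assignment within balls.

The cost of this placement is controlled by replacing distances by their tangent lines. Rotation
invariance then reduces it to `∫ |v 0| = 2 / π * ∫ ‖v‖` and
`∫ max |v 0| |v 1| = √2 * ∫ |v 0|`.
-/

namespace SBM

open Filter ProbabilityTheory
open scoped Topology

section HighProbability

variable {Ω : ℕ → Type*} [∀ n, MeasurableSpace (Ω n)] {P : ∀ n, Measure (Ω n)}
  {A B : ∀ n, Set (Ω n)}

theorem WithHighProbability.mono (hA : WithHighProbability P A) (hAB : ∀ᶠ n in atTop, A n ⊆ B n) :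
    WithHighProbability P B := by
  obtain ⟨M, -, hM⟩ := atTop_basis_Ioi.eventually_iff.1 hAB
  intro δ h0 h1
  obtain ⟨N, hN⟩ := hA δ h0 h1
  refine ⟨max N M, fun n hn => ?_⟩
  obtain ⟨E, hE, hEA, hPE⟩ := hN n ((le_max_left _ _).trans_lt hn)
  exact ⟨E, hE, hEA.trans (hM ((le_max_right _ _).trans_lt hn)), hPE⟩

variable [∀ n, IsProbabilityMeasure (P n)]

theorem withHighProbability_iff_forall_eventually_compl_lt :
    WithHighProbability P A ↔ ∀ δ : ℝ, 0 < δ → ∀ᶠ n in atTop,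
      ∃ E : Set (Ω n), MeasurableSet E ∧ E ⊆ A n ∧ (P n).real Eᶜ < δ := by
  have lt_iff (n : ℕ) {E : Set (Ω n)} (hE : MeasurableSet E) {δ : ℝ} (h1 : δ < 1) :
      ENNReal.ofReal (1 - δ) < P n E ↔ (P n).real Eᶜ < δ := by
    rw [ENNReal.ofReal_lt_iff_lt_toReal (by linarith) (measure_ne_top _ _), ← measureReal_def,
      probReal_compl_eq_one_sub hE, sub_lt_comm]
  constructor
  · intro h δ hδ
    have hδ1 : min δ (1 / 2) < 1 := (min_le_right _ _).trans_lt (by norm_num)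
    obtain ⟨N, hN⟩ := h (min δ (1 / 2)) (by positivity) hδ1
    filter_upwards [eventually_gt_atTop N] with n hn
    obtain ⟨E, hE, hEA, hPE⟩ := hN n hn
    exact ⟨E, hE, hEA, ((lt_iff n hE hδ1).1 hPE).trans_le (min_le_left _ _)⟩
  · intro h δ h0 h1
    obtain ⟨N, -, hN⟩ := atTop_basis_Ioi.eventually_iff.1 (h δ h0)
    refine ⟨N, fun n hn => ?_⟩
    obtain ⟨E, hE, hEA, hPE⟩ := hN hn
    exact ⟨E, hE, hEA, (lt_iff n hE h1).2 hPE⟩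

theorem WithHighProbability.of_tendsto_compl (hA : ∀ n, MeasurableSet (A n))
    (h : Tendsto (fun n => (P n).real (A n)ᶜ) atTop (𝓝 0)) : WithHighProbability P A :=
  withHighProbability_iff_forall_eventually_compl_lt.2 fun _ hδ =>
    (h.eventually_lt_const hδ).mono fun n hn => ⟨A n, hA n, subset_rfl, hn⟩

theorem WithHighProbability.inter (hA : WithHighProbability P A) (hB : WithHighProbability P B) :
    WithHighProbability P fun n => A n ∩ B n := by
  rw [withHighProbability_iff_forall_eventually_compl_lt] at hA hB ⊢
  intro δ hδ
  filter_upwards [hA (δ / 2) (half_pos hδ), hB (δ / 2) (half_pos hδ)] with n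
  rintro ⟨E, hE, hEA, hPE⟩ ⟨F, hF, hFB, hPF⟩
  refine ⟨E ∩ F, hE.inter hF, Set.inter_subset_inter hEA hFB, ?_⟩
  calc (P n).real (E ∩ F)ᶜ ≤ (P n).real Eᶜ + (P n).real Fᶜ := by
        rw [Set.compl_inter]; exact measureReal_union_le _ _
    _ < δ / 2 + δ / 2 := add_lt_add hPE hPF
    _ = δ := add_halves δ

theorem WithHighProbability.iInter {κ : Type*} [Finite κ] {A : κ → ∀ n, Set (Ω n)}
    (h : ∀ j, WithHighProbability P (A j)) : WithHighProbability P fun n => ⋂ j, A j n := by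
  classical
  have := Fintype.ofFinite κ
  suffices ∀ s : Finset κ, WithHighProbability P fun n => ⋂ j ∈ s, A j n by
    simpa using this Finset.univ
  intro s
  induction s using Finset.induction_on with
  | empty => exact .of_tendsto_compl (by simp) (by simp)
  | insert j s _ ih => simpa only [Finset.set_biInter_insert] using (h j).inter ih

end HighProbability

section Sampling

variable {m k : ℕ} {μ : Measure (EuclideanSpace ℝ (Fin m))} [IsProbabilityMeasure μ]

instance isProbabilityMeasure_sampleLaw (n : ℕ) : IsProbabilityMeasure (sampleLaw μ k n) := by
  unfold sampleLaw; infer_instance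

theorem integral_sum_sampleLaw {F : Fin k → EuclideanSpace ℝ (Fin m) → ℝ}
    (hF : ∀ i, Integrable (F i) μ) (n : ℕ) :
    ∫ v, ∑ q, F q.1 (v q) ∂(sampleLaw μ k n) = n * ∑ i, ∫ x, F i x ∂μ := by
  rw [sampleLaw, integral_finsetSum _ fun q _ => integrable_comp_eval (hF q.1)]
  have h (q : Fin k × Fin n) : ∫ v, F q.1 (v q) ∂Measure.pi (fun _ => μ) = ∫ x, F q.1 x ∂μ :=
    integral_comp_eval (μ := fun _ => μ) (hF q.1).aestronglyMeasurable
  simp [h, Fintype.sum_prod_type, Finset.mul_sum]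

theorem variance_sum_sampleLaw {F : Fin k → EuclideanSpace ℝ (Fin m) → ℝ}
    (hF : ∀ i, MemLp (F i) 2 μ) (n : ℕ) :
    Var[fun v => ∑ q, F q.1 (v q); sampleLaw μ k n] = n * ∑ i, Var[F i; μ] := by
  have h := variance_sum_pi (μ := fun _ : Fin k × Fin n => μ) (X := fun q => F q.1) fun q => hF q.1
  rw [sampleLaw, ← Finset.sum_fn, h]
  simp [Fintype.sum_prod_type, Finset.mul_sum]

/-- Chebyshev's inequality gives the weak law of large numbers, as the variance grows linearly. -/
theorem whp_abs_sum_sub_lt {F : Fin k → EuclideanSpace ℝ (Fin m) → ℝ}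
    (hm : ∀ i, Measurable (F i)) (hF : ∀ i, MemLp (F i) 2 μ) {ε : ℝ} (hε : 0 < ε) :
    WithHighProbability (fun n => sampleLaw μ k n)
      fun n => {v | |∑ q, F q.1 (v q) - n * ∑ i, ∫ x, F i x ∂μ| < n * ε} := by
  have hmeas (n : ℕ) : Measurable fun v : Fin k × Fin n → EuclideanSpace ℝ (Fin m) =>
      ∑ q, F q.1 (v q) :=
    Finset.measurable_sum _ fun q _ => (hm q.1).comp (measurable_pi_apply q)
  refine .of_tendsto_compl
    (fun n => measurableSet_lt ((hmeas n).sub_const _).abs measurable_const) ?_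
  have hlim : Tendsto (fun n : ℕ => (∑ i, Var[F i; μ]) / ε ^ 2 / n) atTop (𝓝 0) :=
    tendsto_const_div_atTop_nhds_zero_nat _
  refine squeeze_zero' (.of_forall fun _ => measureReal_nonneg) ?_ hlim
  filter_upwards [eventually_gt_atTop 0] with n hn
  have hn' : (0 : ℝ) < n := Nat.cast_pos.2 hn
  have hL : MemLp (fun v => ∑ q, F q.1 (v q)) 2 (sampleLaw μ k n) :=
    memLp_finsetSum _ fun q _ => (hF q.1).comp_measurePreserving (measurePreserving_eval _ q)
  have chebyshev := meas_ge_le_variance_div_sq hL (mul_pos hn' hε)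
  rw [integral_sum_sampleLaw (fun i => (hF i).integrable one_le_two),
    variance_sum_sampleLaw hF] at chebyshev
  have hV : 0 ≤ ∑ i, Var[F i; μ] := Finset.sum_nonneg fun i _ => variance_nonneg _ _
  have hcompl := ENNReal.toReal_le_of_le_ofReal (by positivity) chebyshev
  simp only [Set.compl_ofPred, not_lt]
  refine hcompl.trans_eq ?_
  field_simp

theorem whp_abs_sum_ball_sub_lt {F : EuclideanSpace ℝ (Fin m) → ℝ} (hm : Measurable F)
    (hF : MemLp F 2 μ) (i : Fin k) {ε : ℝ} (hε : 0 < ε) :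
    WithHighProbability (fun n => sampleLaw μ k n)
      fun n => {v | |∑ l, F (v (i, l)) - n * ∫ x, F x ∂μ| < n * ε} := by
  let G : Fin k → EuclideanSpace ℝ (Fin m) → ℝ := Pi.single i F
  have hsum (n : ℕ) (v : Fin k × Fin n → EuclideanSpace ℝ (Fin m)) :
      ∑ q, G q.1 (v q) = ∑ l, F (v (i, l)) := by
    rw [Fintype.sum_prod_type, Fintype.sum_eq_single i fun j hj => by simp [G, hj]]
    simp [G]
  have hint : ∑ j, ∫ x, G j x ∂μ = ∫ x, F x ∂μ := by
    rw [Fintype.sum_eq_single i fun j hj => by simp [G, hj]]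
    simp [G]
  have hGm (j : Fin k) : Measurable (G j) := by
    obtain rfl | hj := eq_or_ne j i
    · simpa [G] using hm
    · simpa [G, hj] using measurable_zero
  have hG (j : Fin k) : MemLp (G j) 2 μ := by
    obtain rfl | hj := eq_or_ne j i
    · simpa [G] using hF
    · simp [G, hj]
  simpa only [hsum, hint] using whp_abs_sum_sub_lt hGm hG hε

theorem whp_norm_sum_ball_sub_le {d : ℕ} {G : EuclideanSpace ℝ (Fin m) → EuclideanSpace ℝ (Fin d)}
    (hm : Measurable G) (hG : MemLp G 2 μ) (i : Fin k) {ε : ℝ} (hε : 0 < ε) :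
    WithHighProbability (fun n => sampleLaw μ k n)
      fun n => {v | ‖∑ l, G (v (i, l)) - (n : ℝ) • ∫ x, G x ∂μ‖ ≤ n * ε} := by
  have hcoord (r : Fin d) : ∫ x, G x r ∂μ = (∫ x, G x ∂μ) r :=
    (EuclideanSpace.proj r : EuclideanSpace ℝ (Fin d) →L[ℝ] ℝ).integral_comp_comm
      (hG.integrable one_le_two)
  have hr (r : Fin d) := whp_abs_sum_ball_sub_lt (μ := μ) (F := fun x => G x r)
    (by fun_prop)
    (hG.continuousLinearMap_comp (EuclideanSpace.proj r : EuclideanSpace ℝ (Fin d) →L[ℝ] ℝ)) i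
    (ε := ε / (d + 1)) (by positivity)
  refine (WithHighProbability.iInter hr).mono (.of_forall fun n v hv => ?_)
  simp only [Set.mem_iInter, Set.mem_ofPred_eq, hcoord] at hv ⊢
  set w := ∑ l, G (v (i, l)) - (n : ℝ) • ∫ x, G x ∂μ
  have hw (r : Fin d) : |w r| ≤ n * (ε / (d + 1)) := by
    simpa [w] using (hv r).le
  calc ‖w‖ ≤ ∑ r, |w r| := by
        conv_lhs => rw [← (EuclideanSpace.basisFun (Fin d) ℝ).sum_repr w]
        exact (norm_sum_le _ _).trans_eq (by simp [norm_smul])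
    _ ≤ d * (n * (ε / (d + 1))) := (Finset.sum_le_sum fun r _ => hw r).trans_eq (by simp)
    _ = n * ε * (d / (d + 1)) := by ring
    _ ≤ n * ε := mul_le_of_le_one_right (by positivity) (by rw [div_le_one] <;> linarith)

theorem whp_forall_of_ae {p : EuclideanSpace ℝ (Fin m) → Prop} (hp : MeasurableSet {x | p x})
    (h : ∀ᵐ x ∂μ, p x) :
    WithHighProbability (fun n => sampleLaw μ k n) fun _ => {v | ∀ q, p (v q)} := by
  have hmeas (n : ℕ) :
      MeasurableSet {v : Fin k × Fin n → EuclideanSpace ℝ (Fin m) | ∀ q, p (v q)} := by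
    rw [Set.ofPred_forall]
    exact .iInter fun q => measurable_pi_apply q hp
  have hae (n : ℕ) : ∀ᵐ v ∂(sampleLaw μ k n), ∀ q, p (v q) :=
    ae_all_iff.2 fun q => (measurePreserving_eval _ q).quasiMeasurePreserving.ae h
  refine .of_tendsto_compl hmeas (tendsto_const_nhds.congr fun n => ?_)
  rw [measureReal_def, show sampleLaw μ k n {v | ∀ q, p (v q)}ᶜ = 0 from hae n]
  rfl

theorem whp_exists_mem {U : Set (EuclideanSpace ℝ (Fin m))} (hU : MeasurableSet U) (h : 0 < μ U)
    (i : Fin k) :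
    WithHighProbability (fun n => sampleLaw μ k n) fun _ => {v | ∃ l, v (i, l) ∈ U} := by
  have hpos : 0 < μ.real U := ENNReal.toReal_pos h.ne' (measure_ne_top _ _)
  refine (whp_abs_sum_ball_sub_lt (F := U.indicator 1) (measurable_one.indicator hU)
    (memLp_indicator_const _ hU _ (by simp)) i hpos).mono (.of_forall fun n v hv => ?_)
  by_contra hcon
  simp only [Set.mem_ofPred_eq, not_exists] at hcon
  have hzero (l : Fin n) : U.indicator (1 : EuclideanSpace ℝ (Fin m) → ℝ) (v (i, l)) = 0 := by
    simp [hcon l]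
  simp only [Set.mem_ofPred_eq, hzero, Finset.sum_const_zero, zero_sub, abs_neg,
    integral_indicator_one hU, abs_of_nonneg (mul_nonneg n.cast_nonneg hpos.le)] at hv
  exact hv.false

end Sampling

section UnitBall

variable {m : ℕ} {μ : Measure (EuclideanSpace ℝ (Fin m))}

theorem IsUnitBallProbability.ae_norm_le_one (hμ : IsUnitBallProbability μ) :
    ∀ᵐ x ∂μ, ‖x‖ ≤ 1 := by
  simpa [ae_iff, Set.compl_def] using hμ.supported

theorem IsUnitBallProbability.memLp_of_continuous (hμ : IsUnitBallProbability μ)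
    {F : EuclideanSpace ℝ (Fin m) → ℝ} (hF : Continuous F) (p : ENNReal) : MemLp F p μ := by
  have := hμ.isProbability
  obtain ⟨C, hC⟩ := (isCompact_closedBall 0 1).exists_bound_of_continuousOn hF.continuousOn
  refine MemLp.of_bound hF.aestronglyMeasurable C ?_
  filter_upwards [hμ.ae_norm_le_one] with x hx
  exact hC x (by simpa using hx)

theorem IsUnitBallProbability.integrable_of_continuous (hμ : IsUnitBallProbability μ)
    {F : EuclideanSpace ℝ (Fin m) → ℝ} (hF : Continuous F) : Integrable F μ :=
  memLp_one_iff_integrable.1 (hμ.memLp_of_continuous hF 1)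

end UnitBall

end SBM

namespace KMedian

section Integer

variable {ι : Type*} [Fintype ι] {k : ℕ} {y : ι → ℝ} {z : ι → ι → ℝ}

theorem IPFeasible.exists_eq_one (h : IPFeasible k y z) (q : ι) : ∃ p, z p q = 1 := by
  by_contra! hz
  have hsum := h.assigned q
  simp [fun p => (h.z_binary p q).resolve_right (hz p)] at hsum

theorem IPFeasible.y_eq_one (h : IPFeasible k y z) {p q : ι} (hz : z p q = 1) : y p = 1 :=
  (h.y_binary p).resolve_left fun hy => by linarith [h.le_open p q]

theorem IPFeasible.card_open (h : IPFeasible k y z) [Fintype {p // y p = 1}] :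
    Fintype.card {p // y p = 1} = k := by
  classical
  have hy (p : ι) : y p = if y p = 1 then 1 else 0 := by
    rcases h.y_binary p with hp | hp <;> simp [hp]
  have hsum := h.sum_open
  rw [Finset.sum_congr rfl fun p _ => hy p, Finset.sum_boole, Nat.cast_inj] at hsum
  rw [Fintype.card_subtype, ← hsum]

theorem IPFeasible.exists_section {κ : Type*} [Fintype κ] (h : IPFeasible (Fintype.card κ) y z)
    {f : ι → κ} (hf : f.Surjective) (hsame : ∀ p q, z p q = 1 → f p = f q) :
    ∃ c : κ → ι, (∀ i, f (c i) = i) ∧ ∀ q, z (c (f q)) q = 1 := by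
  classical
  let g : {p // y p = 1} → κ := fun p => f p
  have hg : g.Surjective := fun i => by
    obtain ⟨q, rfl⟩ := hf i
    obtain ⟨p, hp⟩ := h.exists_eq_one q
    exact ⟨⟨p, h.y_eq_one hp⟩, hsame p q hp⟩
  have hinj : g.Injective :=
    ((Fintype.bijective_iff_surjective_and_card g).2 ⟨hg, h.card_open⟩).injective
  refine ⟨fun i => (Function.surjInv hg i).1, Function.surjInv_eq hg, fun q => ?_⟩
  obtain ⟨p, hp⟩ := h.exists_eq_one q
  have hcenter : Function.surjInv hg (f q) = ⟨p, h.y_eq_one hp⟩ :=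
    hinj ((Function.surjInv_eq hg _).trans (hsame p q hp).symm)
  simpa only [hcenter] using hp

end Integer

section Cost

variable {ι X : Type*} [Fintype ι] [MetricSpace X] {k : ℕ} {x : ι → X} {y : ι → ℝ}
  {z : ι → ι → ℝ}

theorem LPFeasible.sum_dist_le_cost (h : LPFeasible k y z) (x : ι → X) {c : ι → ι}
    (hc : ∀ q, z (c q) q = 1) : ∑ q, dist (x (c q)) (x q) ≤ cost x z := by
  rw [cost, Finset.sum_comm]
  refine Finset.sum_le_sum fun q _ => ?_
  calc dist (x (c q)) (x q) = dist (x (c q)) (x q) * z (c q) q := by rw [hc, mul_one]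
    _ ≤ ∑ p, dist (x p) (x q) * z p q :=
        Finset.single_le_sum (f := fun p => dist (x p) (x q) * z p q)
          (fun p _ => mul_nonneg dist_nonneg (h.z_nonneg p q)) (Finset.mem_univ _)

theorem lpFeasible_indicator [DecidableEq ι] {P : Fin k → ι} (hP : P.Injective) (σ : ι → Fin k) :
    LPFeasible k (fun p => if p ∈ Finset.univ.image P then 1 else 0)
      fun p q => if p = P (σ q) then 1 else 0 where
  assigned q := by simp
  le_open p q := by
    by_cases hp : p = P (σ q) <;> simp only [hp, if_true, if_false]
    · simp
    · split_ifs <;> norm_num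
  sum_open := by simp [Finset.card_image_of_injective _ hP]
  y_nonneg p := by split_ifs <;> norm_num
  z_nonneg p q := by split_ifs <;> norm_num

theorem IsLPOptimal.cost_le_sum_dist (h : IsLPOptimal k x y z) {P : Fin k → ι} (hP : P.Injective)
    (σ : ι → Fin k) : cost x z ≤ ∑ q, dist (x (P (σ q))) (x q) := by
  classical
  refine (h.2 _ _ (lpFeasible_indicator hP σ)).trans_eq ?_
  rw [cost, Finset.sum_comm]
  simp

theorem IsLPOptimal.cost_le_sum_infDist [NeZero k] (h : IsLPOptimal k x y z) {M : Fin k → X}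
    {ε : ℝ} (hsep : ∀ j j', j ≠ j' → 2 * ε ≤ dist (M j) (M j'))
    (hnear : ∀ j, ∃ p, dist (x p) (M j) < ε) :
    cost x z ≤ ∑ q, (Metric.infDist (x q) (Set.range M) + ε) := by
  choose P hP using hnear
  have hPinj : P.Injective := fun j j' hjj' => by
    by_contra hne
    have hj' := hP j'
    rw [← hjj'] at hj'
    linarith [hsep j j' hne, dist_triangle_left (M j) (M j') (x (P j)), hP j]
  have hclosest (q : ι) : ∃ j, Metric.infDist (x q) (Set.range M) = dist (x q) (M j) := by
    obtain ⟨_, ⟨j, rfl⟩, hj⟩ :=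
      (Set.finite_range M).isCompact.exists_infDist_eq_dist (Set.range_nonempty M) (x q)
    exact ⟨j, hj⟩
  choose σ hσ using hclosest
  refine (h.cost_le_sum_dist hPinj σ).trans (Finset.sum_le_sum fun q _ => ?_)
  rw [hσ]
  linarith [dist_triangle_right (x (P (σ q))) (x q) (M (σ q)), hP (σ q)]

end Cost

theorem AchievesExactRecovery.exists_centers {X : Type*} [MetricSpace X] {k n : ℕ} [NeZero k]
    [NeZero n] {x : Fin k × Fin n → X} (h : AchievesExactRecovery x) {M : Fin k → X} {ε : ℝ}
    (hsep : ∀ j j', j ≠ j' → 2 * ε ≤ dist (M j) (M j'))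
    (hnear : ∀ j, ∃ p, dist (x p) (M j) < ε) :
    ∃ c : Fin k → Fin k × Fin n, (∀ i, (c i).1 = i) ∧
      ∑ q, dist (x (c q.1)) (x q) ≤ ∑ q, (Metric.infDist (x q) (Set.range M) + ε) := by
  obtain ⟨y, z, hopt, -, hIP, hsame⟩ := h
  obtain ⟨c, hc, hz⟩ := IPFeasible.exists_section (κ := Fin k) (by simpa using hIP)
    Prod.fst_surjective hsame
  exact ⟨c, hc, (hopt.1.sum_dist_le_cost x hz).trans (hopt.cost_le_sum_infDist hsep hnear)⟩

end KMedian

namespace SBM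

open Filter KMedian
open scoped Topology RealInnerProductSpace

section FermatPoint

variable {E : Type*} [NormedAddCommGroup E] [InnerProductSpace ℝ E]

theorem norm_normalize_le_one (v : E) : ‖NormedSpace.normalize v‖ ≤ 1 := by
  obtain rfl | hv := eq_or_ne v 0
  · simp
  · exact (NormedSpace.norm_normalize hv).le

theorem norm_sub_inner_normalize_le (v w : E) :
    ‖v‖ - ⟪NormedSpace.normalize v, w⟫ ≤ ‖w - v‖ := by
  have hv : ⟪NormedSpace.normalize v, v⟫ = ‖v‖ := by
    obtain rfl | hv := eq_or_ne v 0
    · simp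
    · rw [NormedSpace.normalize, real_inner_smul_left, real_inner_self_eq_norm_sq]
      field_simp [norm_ne_zero_iff.2 hv]
  calc ‖v‖ - ⟪NormedSpace.normalize v, w⟫ = ⟪NormedSpace.normalize v, v - w⟫ := by
        rw [inner_sub_right, hv]
    _ ≤ ‖NormedSpace.normalize v‖ * ‖v - w‖ := real_inner_le_norm _ _
    _ ≤ 1 * ‖v - w‖ := by gcongr; exact norm_normalize_le_one v
    _ = ‖w - v‖ := by rw [one_mul, norm_sub_rev]

theorem sum_norm_sub_le_sum_norm_sub {ι : Type*} (s : Finset ι) (v : ι → E) (w : E) :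
    ∑ l ∈ s, ‖v l‖ - ‖∑ l ∈ s, NormedSpace.normalize (v l)‖ * ‖w‖ ≤ ∑ l ∈ s, ‖w - v l‖ :=
  calc ∑ l ∈ s, ‖v l‖ - ‖∑ l ∈ s, NormedSpace.normalize (v l)‖ * ‖w‖
      ≤ ∑ l ∈ s, ‖v l‖ - ⟪∑ l ∈ s, NormedSpace.normalize (v l), w⟫ :=
        sub_le_sub_left (real_inner_le_norm _ _) _
    _ = ∑ l ∈ s, (‖v l‖ - ⟪NormedSpace.normalize (v l), w⟫) := by
        rw [sum_inner, Finset.sum_sub_distrib]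
    _ ≤ ∑ l ∈ s, ‖w - v l‖ := Finset.sum_le_sum fun l _ => norm_sub_inner_normalize_le (v l) w

end FermatPoint

section Criterion

variable {m k : ℕ}

theorem sum_norm_le_of_achievesExactRecovery {n : ℕ} [NeZero k] [NeZero n]
    {c M : Fin k → EuclideanSpace ℝ (Fin m)} {v : Fin k × Fin n → EuclideanSpace ℝ (Fin m)}
    (h : AchievesExactRecovery (dataPoints c v)) {ε : ℝ}
    (hsep : ∀ j j', j ≠ j' → 2 * ε ≤ dist (M j) (M j'))
    (hnear : ∀ j, ∃ q, dist (dataPoints c v q) (M j) < ε) (hv : ∀ q, ‖v q‖ ≤ 1)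
    (hdir : ∀ i, ‖∑ l, NormedSpace.normalize (v (i, l))‖ ≤ n * ε) :
    ∑ q, ‖v q‖ ≤ ∑ q, Metric.infDist (c q.1 + v q) (Set.range M) + 2 * k * (n * ε) := by
  obtain ⟨p, hp, hcost⟩ := h.exists_centers hsep hnear
  have hdist (q : Fin k × Fin n) :
      dist (dataPoints c v (p q.1)) (dataPoints c v q) = ‖v (p q.1) - v q‖ := by
    simp [dataPoints, hp, dist_eq_norm]
  have hball (i : Fin k) : ∑ l, ‖v (i, l)‖ - n * ε ≤ ∑ l, ‖v (p i) - v (i, l)‖ := by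
    refine le_trans (sub_le_sub_left ?_ _) (sum_norm_sub_le_sum_norm_sub _ _ _)
    exact (mul_le_of_le_one_right (norm_nonneg _) (hv _)).trans (hdir i)
  have hlower : ∑ q, ‖v q‖ - k * (n * ε) ≤ ∑ q : Fin k × Fin n, ‖v (p q.1) - v q‖ := by
    simpa [Fintype.sum_prod_type] using Finset.sum_le_sum fun i (_ : i ∈ Finset.univ) => hball i
  simp only [hdist, Finset.sum_add_distrib, Finset.sum_const, Finset.card_univ, Fintype.card_prod,
    Fintype.card_fin, nsmul_eq_mul, Nat.cast_mul] at hcost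
  simp only [dataPoints] at hcost
  linarith

theorem exists_pos_separating {X : Type*} [MetricSpace X] {ι : Type*} [Finite ι] {M : ι → X}
    (hM : M.Injective) (a : ℝ) {G : ℝ} (hG : 0 < G) :
    ∃ ε > 0, (∀ j j', j ≠ j' → 2 * ε ≤ dist (M j) (M j')) ∧ a * ε ≤ G := by
  have small (b : ℝ) {C : ℝ} (hC : 0 < C) : ∀ᶠ ε in 𝓝[>] (0 : ℝ), b * ε ≤ C :=
    ((Continuous.tendsto' (by fun_prop) 0 0 (by simp)).eventually_le_const hC).filter_mono
      nhdsWithin_le_nhds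
  have hsep : ∀ᶠ ε in 𝓝[>] (0 : ℝ), ∀ j j', j ≠ j' → 2 * ε ≤ dist (M j) (M j') := by
    refine eventually_all.2 fun j => eventually_all.2 fun j' => ?_
    by_cases hjj' : j = j'
    · simp [hjj']
    · simpa [hjj'] using small 2 (dist_pos.2 (hM.ne hjj'))
  exact (eventually_mem_nhdsWithin.and (hsep.and (small a hG))).exists

variable {μ : Measure (EuclideanSpace ℝ (Fin m))}

theorem whp_norm_sum_normalize_le [IsProbabilityMeasure μ]
    (hμ0 : ∫ v, NormedSpace.normalize v ∂μ = 0) (i : Fin k) {ε : ℝ} (hε : 0 < ε) :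
    WithHighProbability (fun n => sampleLaw μ k n)
      fun n => {v | ‖∑ l, NormedSpace.normalize (v (i, l))‖ ≤ n * ε} := by
  have hmeas : Measurable (NormedSpace.normalize : EuclideanSpace ℝ (Fin m) → _) := by
    unfold NormedSpace.normalize; fun_prop
  have hLp : MemLp (NormedSpace.normalize : EuclideanSpace ℝ (Fin m) → _) 2 μ :=
    .of_bound hmeas.aestronglyMeasurable 1 (.of_forall norm_normalize_le_one)
  simpa only [hμ0, smul_zero, sub_zero] using whp_norm_sum_ball_sub_le hmeas hLp i hε

theorem whp_exists_dist_dataPoints_lt [IsProbabilityMeasure μ]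
    {c : Fin k → EuclideanSpace ℝ (Fin m)} {M : EuclideanSpace ℝ (Fin m)} {i : Fin k}
    (hM : M - c i ∈ μ.support) {ε : ℝ} (hε : 0 < ε) :
    WithHighProbability (fun n => sampleLaw μ k n)
      fun _ => {v | ∃ q, dist (dataPoints c v q) M < ε} := by
  have hpos := (Measure.mem_support_iff_forall _).1 hM _ (Metric.ball_mem_nhds _ hε)
  refine (whp_exists_mem Metric.isOpen_ball.measurableSet hpos i).mono (.of_forall ?_)
  rintro n v ⟨l, hl⟩
  refine ⟨(i, l), ?_⟩
  rwa [Metric.mem_ball, dist_eq_norm, sub_sub_eq_add_sub, add_comm, ← dist_eq_norm] at hl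

theorem whp_not_achievesExactRecovery (hμ : IsUnitBallProbability μ)
    (hμ0 : ∫ v, NormedSpace.normalize v ∂μ = 0) {c M : Fin k → EuclideanSpace ℝ (Fin m)}
    (hM : M.Injective) (hmem : ∀ j, ∃ i, M j - c i ∈ μ.support)
    (hcost : ∑ i, ∫ v, Metric.infDist (c i + v) (Set.range M) ∂μ < k * ∫ v, ‖v‖ ∂μ) :
    WithHighProbability (fun n => sampleLaw μ k n)
      fun _ => {v | ¬ AchievesExactRecovery (dataPoints c v)} := by
  have := hμ.isProbability
  have : NeZero k := ⟨by rintro rfl; simp at hcost⟩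
  obtain ⟨ε, hε, hsep, hsmall⟩ := exists_pos_separating hM (2 * k + 1) (sub_pos.2 hcost)
  choose home hhome using hmem
  let F (i : Fin k) (v : EuclideanSpace ℝ (Fin m)) : ℝ :=
    Metric.infDist (c i + v) (Set.range M) - ‖v‖
  have hinf (i : Fin k) : Continuous fun v => Metric.infDist (c i + v) (Set.range M) :=
    (Metric.continuous_infDist_pt _).comp (by fun_prop)
  have hF (i : Fin k) : Continuous (F i) := (hinf i).sub continuous_norm
  have hgain : ∑ i, ∫ v, F i v ∂μ =
      ∑ i, ∫ v, Metric.infDist (c i + v) (Set.range M) ∂μ - k * ∫ v, ‖v‖ ∂μ := by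
    simp [F, integral_sub (hμ.integrable_of_continuous (hinf _))
      (hμ.integrable_of_continuous continuous_norm)]
  have lln := whp_abs_sum_sub_lt (fun i => (hF i).measurable)
    (fun i => hμ.memLp_of_continuous (hF i) 2) hε
  have dir := WithHighProbability.iInter fun i : Fin k => whp_norm_sum_normalize_le hμ0 i hε
  have near := WithHighProbability.iInter fun j => whp_exists_dist_dataPoints_lt (hhome j) hε
  have ball := whp_forall_of_ae (k := k)
    (isClosed_le continuous_norm continuous_const).measurableSet hμ.ae_norm_le_one
  refine ((lln.inter dir).inter (near.inter ball)).mono ?_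
  filter_upwards [eventually_gt_atTop 0] with n hn v
  rintro ⟨⟨hlln, hdir⟩, hnear, hball⟩ hrec
  have : NeZero n := ⟨hn.ne'⟩
  simp only [Set.mem_iInter, Set.mem_ofPred_eq] at hdir hnear hlln
  have hrecovered := sum_norm_le_of_achievesExactRecovery hrec hsep hnear hball hdir
  rw [hgain] at hlln
  have hsum : ∑ q, F q.1 (v q) =
      ∑ q, Metric.infDist (c q.1 + v q) (Set.range M) - ∑ q, ‖v q‖ := Finset.sum_sub_distrib ..
  have hn' : (0 : ℝ) < n := Nat.cast_pos.2 hn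
  have := (abs_lt.1 hlln).2
  have := mul_le_mul_of_nonneg_left hsmall hn'.le
  linarith

end Criterion

section Radial

/-- The radial profile `r ^ m * (1 - r)`, cut off outside the unit ball. For large `m` the mass
concentrates near the unit sphere. -/
noncomputable def profile (m : ℕ) (r : ℝ) : ℝ := r ^ m * max 0 (1 - r)

theorem continuous_profile (m : ℕ) : Continuous (profile m) := by
  unfold profile; fun_prop

theorem profile_nonneg (m : ℕ) {r : ℝ} (hr : 0 ≤ r) : 0 ≤ profile m r :=
  mul_nonneg (pow_nonneg hr _) (le_max_left _ _)

theorem profile_eq_zero (m : ℕ) {r : ℝ} (hr : 1 ≤ r) : profile m r = 0 := by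
  simp [profile, hr]

theorem profile_pos (m : ℕ) {r : ℝ} (h0 : 0 < r) (h1 : r < 1) : 0 < profile m r :=
  mul_pos (pow_pos h0 _) (lt_max_of_lt_right (sub_pos.2 h1))

theorem pow_mul_profile (j m : ℕ) (r : ℝ) : r ^ j * profile m r = profile (j + m) r := by
  rw [profile, profile, pow_add, mul_assoc]

theorem setIntegral_Ioi_profile (m : ℕ) :
    ∫ r in Set.Ioi 0, profile m r = 1 / ((m + 1) * (m + 2)) := by
  have hsupport : ∫ r in Set.Ioi 0, profile m r = ∫ r in (0 : ℝ)..1, profile m r := by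
    rw [intervalIntegral.integral_of_le zero_le_one]
    refine setIntegral_eq_of_subset_of_forall_sdiff_eq_zero (s := Set.Ioc (0 : ℝ) 1)
      measurableSet_Ioi Set.Ioc_subset_Ioi_self fun r hr => profile_eq_zero m ?_
    exact (not_le.1 fun h : r ≤ 1 => hr.2 ⟨hr.1, h⟩).le
  have hpoly : ∫ r in (0 : ℝ)..1, profile m r = ∫ r in (0 : ℝ)..1, (r ^ m - r ^ (m + 1)) := by
    refine intervalIntegral.integral_congr fun r hr => ?_
    rw [Set.uIcc_of_le zero_le_one] at hr
    simp only [profile, max_eq_right (sub_nonneg.2 hr.2)]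
    ring
  rw [hsupport, hpoly, intervalIntegral.integral_sub
    (Continuous.intervalIntegrable (by fun_prop) _ _)
    (Continuous.intervalIntegrable (by fun_prop) _ _), integral_pow, integral_pow]
  have h2 : (m : ℝ) + 1 + 1 = m + 2 := by ring
  have : (m : ℝ) + 2 ≠ 0 := by positivity
  push_cast
  simp only [one_pow, h2]
  field_simp
  ring

variable {d : ℕ} (m : ℕ)

/-- The probability density proportional to `profile m ‖x‖`. -/
noncomputable def radialDensity (x : EuclideanSpace ℝ (Fin d)) : ℝ :=
  profile m ‖x‖ / ∫ x : EuclideanSpace ℝ (Fin d), profile m ‖x‖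

theorem continuous_radialDensity :
    Continuous (radialDensity m : EuclideanSpace ℝ (Fin d) → ℝ) :=
  ((continuous_profile m).comp continuous_norm).div_const _

theorem radialDensity_nonneg (x : EuclideanSpace ℝ (Fin d)) : 0 ≤ radialDensity m x :=
  div_nonneg (profile_nonneg m (norm_nonneg x))
    (integral_nonneg fun y => profile_nonneg m (norm_nonneg y))

theorem radialDensity_eq_zero {x : EuclideanSpace ℝ (Fin d)} (hx : 1 ≤ ‖x‖) :
    radialDensity m x = 0 := by
  rw [radialDensity, profile_eq_zero m hx, zero_div]

theorem integrable_radialDensity :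
    Integrable (radialDensity m : EuclideanSpace ℝ (Fin d) → ℝ) := by
  refine (continuous_radialDensity m).integrable_of_hasCompactSupport
    (.intro (isCompact_closedBall 0 1) fun x hx => radialDensity_eq_zero m ?_)
  exact (not_le.1 (mt mem_closedBall_zero_iff.2 hx)).le

variable (d) in
/-- The rotation-invariant probability measure on the unit ball of `ℝ ^ d` whose density is
proportional to `‖x‖ ^ m * (1 - ‖x‖)`. -/
noncomputable def radialMeasure : Measure (EuclideanSpace ℝ (Fin d)) :=
  volume.withDensity fun x => ENNReal.ofReal (radialDensity m x)

theorem hasContinuousDensity_radialMeasure : HasContinuousDensity (radialMeasure d m) :=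
  ⟨radialDensity m, continuous_radialDensity m, radialDensity_nonneg m, rfl⟩

theorem isRotationInvariant_radialMeasure : IsRotationInvariant (radialMeasure d m) := by
  intro A
  ext s hs
  rw [Measure.map_apply A.continuous.measurable hs, radialMeasure,
    withDensity_apply _ hs, withDensity_apply _ (A.continuous.measurable hs),
    ← A.measurePreserving.setLIntegral_comp_preimage hs
      (continuous_radialDensity m).measurable.ennreal_ofReal]
  simp only [radialDensity, A.norm_map]

variable [NeZero d]

theorem integral_profile_norm :
    ∫ x : EuclideanSpace ℝ (Fin d), profile m ‖x‖ =
      d * volume.real (Metric.ball (0 : EuclideanSpace ℝ (Fin d)) 1) /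
        ((m + d) * (m + d + 1)) := by
  obtain ⟨e, rfl⟩ := Nat.exists_eq_succ_of_ne_zero (NeZero.ne d)
  rw [integral_fun_norm_addHaar volume (profile m)]
  simp only [finrank_euclideanSpace_fin, Nat.succ_eq_add_one, Nat.add_sub_cancel, smul_eq_mul,
    pow_mul_profile, setIntegral_Ioi_profile, nsmul_eq_mul]
  push_cast
  ring

theorem integral_profile_norm_pos : 0 < ∫ x : EuclideanSpace ℝ (Fin d), profile m ‖x‖ := by
  have hd : (0 : ℝ) < d := Nat.cast_pos.2 (NeZero.pos d)
  have hvol : 0 < volume.real (Metric.ball (0 : EuclideanSpace ℝ (Fin d)) 1) :=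
    ENNReal.toReal_pos (Metric.measure_ball_pos _ _ one_pos).ne' measure_ball_lt_top.ne
  rw [integral_profile_norm]
  positivity

theorem radialDensity_pos {x : EuclideanSpace ℝ (Fin d)} (h0 : x ≠ 0) (h1 : ‖x‖ < 1) :
    0 < radialDensity m x :=
  div_pos (profile_pos m (norm_pos_iff.2 h0) h1) (integral_profile_norm_pos m)

theorem integral_radialDensity :
    ∫ x : EuclideanSpace ℝ (Fin d), radialDensity m x = 1 := by
  simp only [radialDensity]
  rw [integral_div, div_self (integral_profile_norm_pos m).ne']

theorem isUnitBallProbability_radialMeasure : IsUnitBallProbability (radialMeasure d m) where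
  isProbability := by
    constructor
    rw [radialMeasure, withDensity_apply _ .univ, Measure.restrict_univ,
      ← ofReal_integral_eq_lintegral_ofReal (integrable_radialDensity m)
        (.of_forall (radialDensity_nonneg m)), integral_radialDensity, ENNReal.ofReal_one]
  supported := by
    have hball := Metric.isClosed_closedBall (x := (0 : EuclideanSpace ℝ (Fin d))) (ε := 1)
    rw [radialMeasure, withDensity_apply _ hball.measurableSet.compl]
    refine setLIntegral_eq_zero hball.measurableSet.compl fun x hx => ?_
    have hx' : 1 ≤ ‖x‖ := (not_le.1 (mt mem_closedBall_zero_iff.2 hx)).le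
    simp [radialDensity_eq_zero m hx']

theorem mem_support_radialMeasure {x : EuclideanSpace ℝ (Fin d)} (hx : ‖x‖ < 1) :
    x ∈ (radialMeasure d m).support := by
  rw [Measure.mem_support_iff_forall]
  intro U hU
  obtain ⟨V, hVU, hV, hxV⟩ := mem_nhds_iff.1 hU
  obtain ⟨y, ⟨hyV, hy1⟩, hy0⟩ :=
    (dense_compl_singleton (0 : EuclideanSpace ℝ (Fin d))).inter_open_nonempty _
      (hV.inter Metric.isOpen_ball) ⟨x, hxV, mem_ball_zero_iff.2 hx⟩
  have hopen : IsOpen (V ∩ {x | 0 < radialDensity m x}) :=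
    hV.inter (isOpen_lt continuous_const (continuous_radialDensity m))
  have hpos : 0 < volume (V ∩ {x | 0 < radialDensity m x}) :=
    hopen.measure_pos volume ⟨y, hyV, radialDensity_pos m hy0 (mem_ball_zero_iff.1 hy1)⟩
  refine lt_of_lt_of_le ?_ (measure_mono hVU)
  rw [radialMeasure, withDensity_apply _ hV.measurableSet,
    setLIntegral_pos_iff (continuous_radialDensity m).measurable.ennreal_ofReal]
  refine hpos.trans_le (measure_mono fun z hz => ⟨?_, hz.1⟩)
  simpa using hz.2

theorem hasMassNearCenter_radialMeasure : HasMassNearCenter (radialMeasure d m) :=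
  fun _ hU h0 => (Measure.mem_support_iff_forall _).1 (mem_support_radialMeasure m (by simp)) _
    (hU.mem_nhds h0)

theorem integral_norm_radialMeasure :
    ∫ x, ‖x‖ ∂(radialMeasure d m) = (m + d) / (m + d + 2) := by
  have hpoint (x : EuclideanSpace ℝ (Fin d)) : radialDensity m x * ‖x‖ =
      profile (1 + m) ‖x‖ / ∫ x : EuclideanSpace ℝ (Fin d), profile m ‖x‖ := by
    rw [← pow_mul_profile, pow_one, radialDensity]
    ring
  have hd : (0 : ℝ) < d := Nat.cast_pos.2 (NeZero.pos d)
  have hpos := integral_profile_norm_pos (d := d) m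
  rw [radialMeasure, integral_withDensity_eq_integral_toReal_smul
    (continuous_radialDensity m).measurable.ennreal_ofReal (by simp)]
  simp only [ENNReal.toReal_ofReal (radialDensity_nonneg m _), smul_eq_mul, hpoint, integral_div]
  rw [integral_profile_norm] at hpos ⊢
  rw [integral_profile_norm]
  have hvol : volume.real (Metric.ball (0 : EuclideanSpace ℝ (Fin d)) 1) ≠ 0 := by
    rintro h; simp [h] at hpos
  push_cast
  have h1 : (1 : ℝ) + m + d = m + d + 1 := by ring
  have h2 : (1 : ℝ) + m + d + 1 = m + d + 2 := by ring
  rw [h2, h1]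
  field_simp

end Radial

section RotationInvariance

variable {m : ℕ} {μ : Measure (EuclideanSpace ℝ (Fin m))} {E : Type*} [NormedAddCommGroup E]
  [NormedSpace ℝ E]

theorem IsRotationInvariant.integral_comp (hμ : IsRotationInvariant μ)
    (A : EuclideanSpace ℝ (Fin m) ≃ₗᵢ[ℝ] EuclideanSpace ℝ (Fin m))
    (F : EuclideanSpace ℝ (Fin m) → E) : ∫ v, F (A v) ∂μ = ∫ v, F v ∂μ := by
  conv_rhs => rw [← hμ A]
  exact (A.toHomeomorph.measurableEmbedding.integral_map F).symm

theorem IsRotationInvariant.integral_eq_zero_of_odd (hμ : IsRotationInvariant μ)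
    {F : EuclideanSpace ℝ (Fin m) → E} (hF : F.Odd) : ∫ v, F v ∂μ = 0 := by
  have h := hμ.integral_comp (LinearIsometryEquiv.neg ℝ) F
  simp only [LinearIsometryEquiv.coe_neg, hF _, integral_neg] at h
  have := IsAddTorsionFree.of_isTorsionFree ℝ E
  exact neg_eq_self.1 h

theorem IsRotationInvariant.integral_sum_comp {ι : Type*} [Fintype ι] (hμ : IsRotationInvariant μ)
    (A : ι → EuclideanSpace ℝ (Fin m) ≃ₗᵢ[ℝ] EuclideanSpace ℝ (Fin m))
    {F : EuclideanSpace ℝ (Fin m) → E} (hF : Integrable F μ) :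
    ∫ v, ∑ i, F (A i v) ∂μ = Fintype.card ι • ∫ v, F v ∂μ := by
  have hint (i : ι) : Integrable (fun v => F (A i v)) μ :=
    (A i).toHomeomorph.measurableEmbedding.integrable_map_iff.1 ((hμ (A i)).symm ▸ hF)
  rw [integral_finsetSum _ fun i _ => hint i]
  simp only [hμ.integral_comp, Finset.sum_const, Finset.card_univ]

end RotationInvariance

section Plane

open Real

/-- The Euclidean plane. -/
abbrev Plane : Type := EuclideanSpace ℝ (Fin 2)

/-- The counterclockwise rotation of the plane by the angle `θ`. -/
noncomputable def planeRotation (θ : ℝ) : Plane ≃ₗᵢ[ℝ] Plane :=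
  Complex.orthonormalBasisOneI.repr.symm.trans
    ((rotation (Circle.exp θ)).trans Complex.orthonormalBasisOneI.repr)

@[simp]
theorem planeRotation_apply_zero (θ : ℝ) (v : Plane) :
    planeRotation θ v 0 = cos θ * v 0 - sin θ * v 1 := by
  simp [planeRotation, Complex.exp_ofReal_mul_I_re, Complex.exp_ofReal_mul_I_im]

@[simp]
theorem planeRotation_apply_one (θ : ℝ) (v : Plane) :
    planeRotation θ v 1 = sin θ * v 0 + cos θ * v 1 := by
  simp [planeRotation, Complex.exp_ofReal_mul_I_re, Complex.exp_ofReal_mul_I_im, add_comm]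

theorem integral_abs_cos_add (θ : ℝ) : ∫ t in (0 : ℝ)..π, |cos (t + θ)| = 2 := by
  have hper : Function.Periodic (fun t => |cos t|) π := fun t => by simp [cos_add_pi]
  have hcos : Set.EqOn (fun t => |cos t|) cos (Set.uIcc (-(π / 2)) (π / 2)) := fun t ht =>
    abs_of_nonneg (cos_nonneg_of_mem_Icc (by rwa [Set.uIcc_of_le (by linarith [pi_pos])] at ht))
  calc ∫ t in (0 : ℝ)..π, |cos (t + θ)| = ∫ t in θ..θ + π, |cos t| := by
        rw [intervalIntegral.integral_comp_add_right fun t => |cos t|, zero_add, add_comm π θ]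
    _ = ∫ t in -(π / 2)..-(π / 2) + π, |cos t| := hper.intervalIntegral_add_eq ..
    _ = ∫ t in -(π / 2)..π / 2, cos t := by
        rw [show -(π / 2) + π = π / 2 by ring, intervalIntegral.integral_congr hcos]
    _ = 2 := by norm_num [integral_cos]

theorem integral_abs_planeRotation_apply_zero (v : Plane) :
    ∫ t in (0 : ℝ)..π, |planeRotation t v 0| = 2 * ‖v‖ := by
  obtain ⟨z, rfl⟩ := Complex.orthonormalBasisOneI.repr.surjective v
  have hpolar (t : ℝ) : |planeRotation t (Complex.orthonormalBasisOneI.repr z) 0| =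
      ‖z‖ * |cos (t + z.arg)| := by
    rw [← abs_norm z, ← abs_mul, cos_add]
    congr 1
    simp only [planeRotation_apply_zero, Complex.orthonormalBasisOneI_repr_apply,
      Matrix.cons_val_zero, Matrix.cons_val_one]
    linear_combination -cos t * Complex.norm_mul_cos_arg z + sin t * Complex.norm_mul_sin_arg z
  simp only [hpolar, intervalIntegral.integral_const_mul, integral_abs_cos_add,
    LinearIsometryEquiv.norm_map]
  ring

variable {μ : Measure Plane}

theorem integrable_uncurry_abs_planeRotation [SFinite μ] (h : Integrable (fun v : Plane => ‖v‖) μ) :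
    Integrable (Function.uncurry fun (t : ℝ) (v : Plane) => |planeRotation t v 0|)
      ((volume.restrict (Set.Ioc 0 π)).prod μ) := by
  refine (h.comp_snd (volume.restrict (Set.Ioc 0 π))).mono' ?_ (.of_forall fun p => ?_)
  · simp only [Function.uncurry_def, planeRotation_apply_zero]
    exact Continuous.aestronglyMeasurable (by fun_prop)
  · simpa [Function.uncurry_def] using PiLp.norm_apply_le (planeRotation p.1 p.2) 0

theorem IsRotationInvariant.pi_mul_integral_abs [SFinite μ] (hμ : IsRotationInvariant μ)
    (h : Integrable (fun v : Plane => ‖v‖) μ) :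
    π * ∫ v, |v 0| ∂μ = 2 * ∫ v, ‖v‖ ∂μ :=
  calc π * ∫ v, |v 0| ∂μ = ∫ t in (0 : ℝ)..π, ∫ v, |planeRotation t v 0| ∂μ := by
        simp only [fun t => hμ.integral_comp (planeRotation t) fun v => |v 0|]
        simp
    _ = ∫ v, (∫ t in (0 : ℝ)..π, |planeRotation t v 0|) ∂μ := by
        simp only [intervalIntegral.integral_of_le pi_pos.le]
        exact integral_integral_swap (integrable_uncurry_abs_planeRotation h)
    _ = 2 * ∫ v, ‖v‖ ∂μ := by
        simp only [integral_abs_planeRotation_apply_zero, integral_const_mul]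

theorem max_abs_abs_eq_planeRotation (v : Plane) :
    max |v 0| |v 1| = √2 / 2 * (|planeRotation (π / 4) v 0| + |planeRotation (-(π / 4)) v 0|) := by
  have hmax (a b : ℝ) : max |a| |b| = (|a - b| + |a + b|) / 2 := by grind
  have hsqrt : √2 / 2 * (√2 / 2) = 1 / 2 := by
    rw [div_mul_div_comm, mul_self_sqrt two_pos.le]; norm_num
  simp only [planeRotation_apply_zero, cos_neg, sin_neg, cos_pi_div_four, sin_pi_div_four, neg_mul,
    sub_neg_eq_add, ← mul_sub, ← mul_add, abs_mul, abs_of_pos (half_pos (sqrt_pos.2 two_pos))]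
  rw [hmax, ← mul_assoc, hsqrt]
  ring

theorem IsRotationInvariant.integral_max_abs_abs (hμ : IsRotationInvariant μ)
    (h : Integrable (fun v : Plane => ‖v‖) μ) :
    ∫ v : Plane, max |v 0| |v 1| ∂μ = √2 * ∫ v : Plane, |v 0| ∂μ := by
  have hint (θ : ℝ) : Integrable (fun v => |planeRotation θ v 0|) μ :=
    h.mono' (Continuous.aestronglyMeasurable (by fun_prop)) (.of_forall fun v => by
      simpa using PiLp.norm_apply_le (planeRotation θ v) 0)
  simp only [max_abs_abs_eq_planeRotation]
  rw [integral_const_mul, integral_add (hint _) (hint _), hμ.integral_comp _ fun v => |v 0|,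
    hμ.integral_comp _ fun v => |v 0|]
  ring

end Plane

section TangentBound

/-- The tangent line bound `√a ≤ (s + a / s) / 2` at `a = 1 + r ^ 2 - 2 * t`, which is an upper
bound for the squared distance of a vector of norm `r` to a point of the unit ball, `t` being their
inner product. The free parameter `s` is a guess for the distance. Being affine in `t`, the bound
can be integrated. -/
noncomputable def tangentBound (s r t : ℝ) : ℝ := (s + (1 + r ^ 2 - 2 * t) / s) / 2

@[simp]
theorem tangentBound_neg (s r t : ℝ) : tangentBound s (-r) t = tangentBound s r t := by
  rw [tangentBound, tangentBound, neg_sq]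

theorem norm_sub_le_tangentBound {E : Type*} [NormedAddCommGroup E] [InnerProductSpace ℝ E]
    {v : E} (hv : ‖v‖ ≤ 1) (w : E) {s : ℝ} (hs : 0 < s) :
    ‖v - w‖ ≤ tangentBound s ‖w‖ ⟪w, v⟫ := by
  have hsq : ‖v - w‖ ^ 2 ≤ 1 + ‖w‖ ^ 2 - 2 * ⟪w, v⟫ := by
    rw [norm_sub_sq_real, real_inner_comm]
    linarith [pow_le_one₀ (n := 2) (norm_nonneg v) hv]
  have hamgm : 2 * ‖v - w‖ ≤ s + ‖v - w‖ ^ 2 / s := by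
    rw [← sub_nonneg, show s + ‖v - w‖ ^ 2 / s - 2 * ‖v - w‖ = (s - ‖v - w‖) ^ 2 / s by
      field_simp; ring]
    positivity
  have hdiv := div_le_div_of_nonneg_right hsq hs.le
  rw [tangentBound]
  linarith

variable {m : ℕ} {μ : Measure (EuclideanSpace ℝ (Fin m))} {S : Set (EuclideanSpace ℝ (Fin m))}
  {c v w : EuclideanSpace ℝ (Fin m)} {s b : ℝ} {r : Fin m}

theorem infDist_add_le_tangentBound (h : c + w ∈ S) (hv : ‖v‖ ≤ 1) (hs : 0 < s) :
    Metric.infDist (c + v) S ≤ tangentBound s ‖w‖ ⟪w, v⟫ := by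
  refine (Metric.infDist_le_dist_of_mem h).trans ?_
  rw [dist_add_left, dist_eq_norm]
  exact norm_sub_le_tangentBound hv w hs

theorem infDist_add_le_tangentBound_apply (h : c + b • EuclideanSpace.single r 1 ∈ S)
    (hv : ‖v‖ ≤ 1) (hs : 0 < s) : Metric.infDist (c + v) S ≤ tangentBound s b (b * v r) := by
  simpa [tangentBound, norm_smul, real_inner_smul_left, EuclideanSpace.inner_single_left] using
    infDist_add_le_tangentBound h hv hs

theorem infDist_add_le_tangentBound_abs_apply (h : c + b • EuclideanSpace.single r 1 ∈ S)
    (h' : c + (-b) • EuclideanSpace.single r 1 ∈ S) (hv : ‖v‖ ≤ 1) (hs : 0 < s) :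
    Metric.infDist (c + v) S ≤ tangentBound s b (b * |v r|) := by
  have hpos := infDist_add_le_tangentBound_apply h hv hs
  have hneg := infDist_add_le_tangentBound_apply h' hv hs
  rcases abs_choice (v r) with hr | hr <;> rw [hr]
  · exact hpos
  · simpa [tangentBound] using hneg

theorem integral_tangentBound [IsProbabilityMeasure μ] {F : EuclideanSpace ℝ (Fin m) → ℝ}
    (hF : Integrable F μ) (s r : ℝ) :
    ∫ v, tangentBound s r (F v) ∂μ = tangentBound s r (∫ v, F v ∂μ) := by
  have haffine (t : ℝ) : tangentBound s r t = (s + (1 + r ^ 2) / s) / 2 - s⁻¹ * t := by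
    rw [tangentBound]; ring
  simp only [haffine]
  rw [integral_sub (integrable_const _) (hF.const_mul _), integral_const_mul]
  simp

theorem IsUnitBallProbability.integral_infDist_add_le_of_le (hμ : IsUnitBallProbability μ)
    {F : EuclideanSpace ℝ (Fin m) → ℝ} (hF : Continuous F)
    (h : ∀ v, ‖v‖ ≤ 1 → Metric.infDist (c + v) S ≤ tangentBound s b (F v)) :
    ∫ v, Metric.infDist (c + v) S ∂μ ≤ tangentBound s b (∫ v, F v ∂μ) := by
  have := hμ.isProbability
  rw [← integral_tangentBound (hμ.integrable_of_continuous hF)]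
  refine integral_mono_ae (hμ.integrable_of_continuous ?_) (hμ.integrable_of_continuous ?_)
    (hμ.ae_norm_le_one.mono h)
  · exact (Metric.continuous_infDist_pt S).comp (by fun_prop)
  · unfold tangentBound; fun_prop

theorem integral_infDist_add_le_of_mem (hμ : IsUnitBallProbability μ) (hrot : IsRotationInvariant μ)
    {x : EuclideanSpace ℝ (Fin m)} (hx : x ∈ S) :
    ∫ v, Metric.infDist (c + v) S ∂μ ≤ 1 + dist x c ^ 2 / 2 := by
  have hmean : ∫ v, ⟪x - c, v⟫ ∂μ = 0 :=
    hrot.integral_eq_zero_of_odd fun v => inner_neg_right (x - c) v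
  have hle := hμ.integral_infDist_add_le_of_le (F := fun v => ⟪x - c, v⟫) (by fun_prop)
    fun v hv => infDist_add_le_tangentBound (by rwa [add_sub_cancel]) hv one_pos
  rw [hmean, tangentBound] at hle
  rw [dist_eq_norm]
  linarith

theorem integral_infDist_add_le_of_two (hμ : IsUnitBallProbability μ) (hs : 0 < s)
    (h : c + b • EuclideanSpace.single r 1 ∈ S) (h' : c + (-b) • EuclideanSpace.single r 1 ∈ S) :
    ∫ v, Metric.infDist (c + v) S ∂μ ≤ tangentBound s b (b * ∫ v, |v r| ∂μ) := by
  rw [← integral_const_mul]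
  exact hμ.integral_infDist_add_le_of_le (by fun_prop) fun v hv =>
    infDist_add_le_tangentBound_abs_apply h h' hv hs

end TangentBound

section Cross

open Real

variable {μ : Measure Plane} {S : Set Plane} {c v : Plane} {s₁ s₂ b₁ b₂ : ℝ}

theorem planeRotation_pi_div_two_twice (v : Plane) :
    planeRotation (π / 2) (planeRotation (π / 2) v) = -v := by
  ext r
  fin_cases r <;> simp

theorem sum_infDist_quarterTurns_le_apply_zero (hs₁ : 0 < s₁) (hs₂ : 0 < s₂)
    (hE : c + b₁ • EuclideanSpace.single 0 1 ∈ S) (hN : c + b₂ • EuclideanSpace.single 1 1 ∈ S)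
    (hW : c + (-b₂) • EuclideanSpace.single 0 1 ∈ S)
    (hS : c + (-b₂) • EuclideanSpace.single 1 1 ∈ S) (hv : ‖v‖ ≤ 1) :
    Metric.infDist (c + v) S + Metric.infDist (c + planeRotation (π / 2) v) S +
        Metric.infDist (c + -v) S + Metric.infDist (c + -planeRotation (π / 2) v) S ≤
      tangentBound s₁ b₁ (b₁ * v 0) + 3 * tangentBound s₂ b₂ (b₂ * v 0) := by
  have hturn : ‖planeRotation (π / 2) v‖ ≤ 1 := by rwa [LinearIsometryEquiv.norm_map]
  have east := infDist_add_le_tangentBound_apply hE hv hs₁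
  have north := infDist_add_le_tangentBound_apply hN hturn hs₂
  have west := infDist_add_le_tangentBound_apply hW ((norm_neg v).trans_le hv) hs₂
  have south := infDist_add_le_tangentBound_apply hS ((norm_neg _).trans_le hturn) hs₂
  simp only [tangentBound_neg, PiLp.neg_apply, neg_mul_neg, planeRotation_apply_one,
    sin_pi_div_two, cos_pi_div_two, one_mul, zero_mul, add_zero] at north west south
  linarith

theorem sum_infDist_quarterTurns_le (hs₁ : 0 < s₁) (hs₂ : 0 < s₂)
    (hE : c + b₁ • EuclideanSpace.single 0 1 ∈ S) (hN : c + b₂ • EuclideanSpace.single 1 1 ∈ S)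
    (hW : c + (-b₂) • EuclideanSpace.single 0 1 ∈ S)
    (hS : c + (-b₂) • EuclideanSpace.single 1 1 ∈ S) (hv : ‖v‖ ≤ 1) :
    Metric.infDist (c + v) S + Metric.infDist (c + planeRotation (π / 2) v) S +
        Metric.infDist (c + -v) S + Metric.infDist (c + -planeRotation (π / 2) v) S ≤
      tangentBound s₁ b₁ (b₁ * max |v 0| |v 1|) +
        3 * tangentBound s₂ b₂ (b₂ * max |v 0| |v 1|) := by
  -- The sum only depends on the orbit of `v`, so `v` may be replaced by `u`, the point of its orbit
  -- closest to the positive first axis.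
  have hbound (u : Plane) (hu : ‖u‖ ≤ 1) :=
    sum_infDist_quarterTurns_le_apply_zero hs₁ hs₂ hE hN hW hS hu
  have hturn : ‖planeRotation (π / 2) v‖ ≤ 1 := by rwa [LinearIsometryEquiv.norm_map]
  have key (t : ℝ) (ht : t = v 0 ∨ t = -v 0 ∨ t = v 1 ∨ t = -v 1) :
      Metric.infDist (c + v) S + Metric.infDist (c + planeRotation (π / 2) v) S +
          Metric.infDist (c + -v) S + Metric.infDist (c + -planeRotation (π / 2) v) S ≤
        tangentBound s₁ b₁ (b₁ * t) + 3 * tangentBound s₂ b₂ (b₂ * t) := by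
    rcases ht with rfl | rfl | rfl | rfl
    · exact hbound v hv
    · have h := hbound (-v) ((norm_neg v).trans_le hv)
      simp only [map_neg, neg_neg, PiLp.neg_apply] at h
      linarith
    · have h := hbound (-planeRotation (π / 2) v) ((norm_neg _).trans_le hturn)
      simp only [map_neg, planeRotation_pi_div_two_twice, neg_neg, PiLp.neg_apply,
        planeRotation_apply_zero, cos_pi_div_two, sin_pi_div_two, zero_mul, one_mul, zero_sub] at h
      linarith
    · have h := hbound (planeRotation (π / 2) v) hturn
      simp only [planeRotation_pi_div_two_twice, neg_neg,
        planeRotation_apply_zero, cos_pi_div_two, sin_pi_div_two, zero_mul, one_mul, zero_sub] at h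
      linarith
  apply key
  grind

theorem integral_infDist_add_le_of_four (hμ : IsUnitBallProbability μ)
    (hrot : IsRotationInvariant μ) (hs₁ : 0 < s₁) (hs₂ : 0 < s₂)
    (hE : c + b₁ • EuclideanSpace.single 0 1 ∈ S) (hN : c + b₂ • EuclideanSpace.single 1 1 ∈ S)
    (hW : c + (-b₂) • EuclideanSpace.single 0 1 ∈ S)
    (hS : c + (-b₂) • EuclideanSpace.single 1 1 ∈ S) :
    4 * ∫ v, Metric.infDist (c + v) S ∂μ ≤
      tangentBound s₁ b₁ (b₁ * (√2 * ∫ v, |v 0| ∂μ)) +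
        3 * tangentBound s₂ b₂ (b₂ * (√2 * ∫ v, |v 0| ∂μ)) := by
  have := hμ.isProbability
  have hinfDist : Continuous fun v => Metric.infDist (c + v) S :=
    (Metric.continuous_infDist_pt S).comp (by fun_prop)
  have hmax (b : ℝ) : Integrable (fun v : Plane => b * max |v 0| |v 1|) μ :=
    hμ.integrable_of_continuous (by fun_prop)
  have hbound (s b : ℝ) : Integrable (fun v : Plane => tangentBound s b (b * max |v 0| |v 1|)) μ :=
    hμ.integrable_of_continuous (by unfold tangentBound; fun_prop)
  let turns : Fin 4 → Plane ≃ₗᵢ[ℝ] Plane :=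
    ![.refl ℝ Plane, planeRotation (π / 2), .neg ℝ, (planeRotation (π / 2)).trans (.neg ℝ)]
  calc 4 * ∫ v, Metric.infDist (c + v) S ∂μ
      = ∫ v, ∑ i, Metric.infDist (c + turns i v) S ∂μ := by
        simp [hrot.integral_sum_comp turns (hμ.integrable_of_continuous hinfDist)]
    _ ≤ ∫ v, (tangentBound s₁ b₁ (b₁ * max |v 0| |v 1|) +
          3 * tangentBound s₂ b₂ (b₂ * max |v 0| |v 1|)) ∂μ := by
        refine integral_mono_ae (hμ.integrable_of_continuous (by fun_prop))
          ((hbound s₁ b₁).add ((hbound s₂ b₂).const_mul 3))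
          (hμ.ae_norm_le_one.mono fun v hv => ?_)
        simpa [turns, Fin.sum_univ_four] using
          sum_infDist_quarterTurns_le hs₁ hs₂ hE hN hW hS hv
    _ = _ := by
        rw [integral_add (hbound s₁ b₁) ((hbound s₂ b₂).const_mul 3), integral_const_mul,
          integral_tangentBound (hmax b₁), integral_tangentBound (hmax b₂), integral_const_mul,
          integral_const_mul,
          hrot.integral_max_abs_abs (hμ.integrable_of_continuous continuous_norm)]

end Cross

section Configuration

open Real

/-- The points of the plane with coordinates in `ℤ / 5`, among which the ball centers and the
competing medians are chosen. -/
noncomputable def fifthLattice (a : ℤ × ℤ) : Plane := !₂[a.1 / 5, a.2 / 5]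

theorem fifthLattice_injective : Function.Injective fifthLattice := fun a b h => by
  have h₀ := congrArg (fun v : Plane => v 0) h
  have h₁ := congrArg (fun v : Plane => v 1) h
  ext
  · simpa [fifthLattice] using h₀
  · simpa [fifthLattice] using h₁

theorem dist_fifthLattice_sq (a b : ℤ × ℤ) :
    dist (fifthLattice a) (fifthLattice b) ^ 2 =
      ((a.1 - b.1) ^ 2 + (a.2 - b.2) ^ 2 : ℤ) / 5 ^ 2 := by
  rw [EuclideanSpace.dist_sq_eq, Fin.sum_univ_two]
  simp only [fifthLattice, dist_eq, sq_abs, PiLp.toLp_apply, Matrix.cons_val_zero,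
    Matrix.cons_val_one, ← sub_div, div_pow, ← add_div]
  push_cast
  rfl

/-- The coordinates of the seven ball centers, in units of `1 / 5`: the balls around them form a
cross of five balls with two more balls attached in opposite corners. -/
def gridCenterCoord : Fin 7 → ℤ × ℤ :=
  ![(0, 0), (11, 0), (0, 11), (-11, 0), (0, -11), (11, 11), (-11, -11)]

/-- The coordinates, in units of `1 / 5`, of seven medians that beat one median per ball: the first
two share ball `1`, and ball `0` has none. -/
def gridMedianCoord : Fin 7 → ℤ × ℤ :=
  ![(15, 0), (7, 0), (0, 10), (-10, 0), (0, -10), (11, 11), (-11, -11)]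

/-- The centers of the seven balls, as points of the plane. -/
noncomputable def gridCenter (i : Fin 7) : Plane := fifthLattice (gridCenterCoord i)

/-- The seven competing medians, as points of the plane. -/
noncomputable def gridMedian (j : Fin 7) : Plane := fifthLattice (gridMedianCoord j)

theorem gridMedian_injective : Function.Injective gridMedian :=
  fifthLattice_injective.comp (by decide : Function.Injective gridMedianCoord)

theorem isLeast_dist_gridCenter :
    IsLeast {t : ℝ | ∃ i j : Fin 7, i ≠ j ∧ t = dist (gridCenter i) (gridCenter j)} 2.2 := by
  have hsq : ∀ i j : Fin 7, i ≠ j → 11 ^ 2 ≤ ((gridCenterCoord i).1 - (gridCenterCoord j).1) ^ 2 +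
      ((gridCenterCoord i).2 - (gridCenterCoord j).2) ^ 2 := by
    decide
  refine ⟨⟨0, 1, by decide, ?_⟩, ?_⟩
  · rw [← sq_eq_sq₀ (by norm_num) dist_nonneg, gridCenter, gridCenter, dist_fifthLattice_sq]
    norm_num [gridCenterCoord]
  · rintro _ ⟨i, j, hij, rfl⟩
    rw [← sq_le_sq₀ (by norm_num) dist_nonneg, gridCenter, gridCenter, dist_fifthLattice_sq,
      le_div_iff₀ (by norm_num)]
    exact le_trans (by norm_num) (Int.cast_le.2 (hsq i j hij))

theorem exists_dist_gridMedian_gridCenter_lt (j : Fin 7) :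
    ∃ i, dist (gridMedian j) (gridCenter i) < 1 := by
  have hsq : ∀ j : Fin 7, ∃ i : Fin 7, ((gridMedianCoord j).1 - (gridCenterCoord i).1) ^ 2 +
      ((gridMedianCoord j).2 - (gridCenterCoord i).2) ^ 2 < 5 ^ 2 := by
    decide
  obtain ⟨i, hi⟩ := hsq j
  refine ⟨i, ?_⟩
  rw [← sq_lt_sq₀ dist_nonneg one_pos.le, gridMedian, gridCenter, dist_fifthLattice_sq,
    div_lt_iff₀ (by norm_num)]
  exact (Int.cast_lt.2 hi).trans_eq (by norm_num)

theorem gridCenter_add_smul_single_zero_mem {i j : Fin 7} {a : ℤ} {b : ℝ}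
    (h : gridMedianCoord j = gridCenterCoord i + (a, 0)) (hb : a = 5 * b) :
    gridCenter i + b • EuclideanSpace.single 0 1 ∈ Set.range gridMedian := by
  refine ⟨j, PiLp.ext fun r => ?_⟩
  fin_cases r <;> simp [gridMedian, gridCenter, fifthLattice, h, hb, add_div]

theorem gridCenter_add_smul_single_one_mem {i j : Fin 7} {a : ℤ} {b : ℝ}
    (h : gridMedianCoord j = gridCenterCoord i + (0, a)) (hb : a = 5 * b) :
    gridCenter i + b • EuclideanSpace.single 1 1 ∈ Set.range gridMedian := by
  refine ⟨j, PiLp.ext fun r => ?_⟩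
  fin_cases r <;> simp [gridMedian, gridCenter, fifthLattice, h, hb, add_div]

variable {μ : Measure Plane}

theorem integral_infDist_gridCenter_zero_le (hμ : IsUnitBallProbability μ)
    (hrot : IsRotationInvariant μ) :
    4 * ∫ v, Metric.infDist (gridCenter 0 + v) (Set.range gridMedian) ∂μ ≤
      tangentBound (2 / 3) (7 / 5) (7 / 5 * (√2 * ∫ v, |v 0| ∂μ)) +
        3 * tangentBound (6 / 5) 2 (2 * (√2 * ∫ v, |v 0| ∂μ)) :=
  integral_infDist_add_le_of_four hμ hrot (by norm_num) (by norm_num)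
    (gridCenter_add_smul_single_zero_mem (j := 1) (a := 7) rfl (by norm_num))
    (gridCenter_add_smul_single_one_mem (j := 2) (a := 10) rfl (by norm_num))
    (gridCenter_add_smul_single_zero_mem (j := 3) (a := -10) rfl (by norm_num))
    (gridCenter_add_smul_single_one_mem (j := 4) (a := -10) rfl (by norm_num))

theorem integral_infDist_gridCenter_one_le (hμ : IsUnitBallProbability μ) :
    ∫ v, Metric.infDist (gridCenter 1 + v) (Set.range gridMedian) ∂μ ≤
      tangentBound (4 / 5) (4 / 5) (4 / 5 * ∫ v, |v 0| ∂μ) :=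
  integral_infDist_add_le_of_two hμ (by norm_num)
    (gridCenter_add_smul_single_zero_mem (j := 0) (a := 4) rfl (by norm_num))
    (gridCenter_add_smul_single_zero_mem (j := 1) (a := -4) rfl (by norm_num))

theorem integral_infDist_gridCenter_le_of_two_le (hμ : IsUnitBallProbability μ)
    (hrot : IsRotationInvariant μ) {i : Fin 7} (hi : 2 ≤ i) :
    ∫ v, Metric.infDist (gridCenter i + v) (Set.range gridMedian) ∂μ ≤ 51 / 50 := by
  have hsq : ∀ i : Fin 7, 2 ≤ i → ((gridMedianCoord i).1 - (gridCenterCoord i).1) ^ 2 +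
      ((gridMedianCoord i).2 - (gridCenterCoord i).2) ^ 2 ≤ 1 := by
    decide
  have hdist : dist (gridMedian i) (gridCenter i) ^ 2 ≤ 1 / 5 ^ 2 := by
    rw [gridMedian, gridCenter, dist_fifthLattice_sq]
    gcongr
    exact_mod_cast hsq i hi
  linarith [integral_infDist_add_le_of_mem (c := gridCenter i) hμ hrot
    (Set.mem_range_self (f := gridMedian) i)]

theorem sum_integral_infDist_gridCenter_lt (hμ : IsUnitBallProbability μ)
    (hrot : IsRotationInvariant μ) (hmean : 199 / 200 ≤ ∫ v, ‖v‖ ∂μ) :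
    ∑ i, ∫ v, Metric.infDist (gridCenter i + v) (Set.range gridMedian) ∂μ <
      7 * ∫ v, ‖v‖ ∂μ := by
  have := hμ.isProbability
  have habs : 633 / 1000 ≤ ∫ v, |v 0| ∂μ := by
    have h := hrot.pi_mul_integral_abs (hμ.integrable_of_continuous continuous_norm)
    have hnonneg : 0 ≤ ∫ v, |v 0| ∂μ := integral_nonneg fun v => abs_nonneg _
    nlinarith [pi_lt_d4]
  have hmax : 895 / 1000 ≤ √2 * ∫ v, |v 0| ∂μ := by
    have hsqrt : 1.4142 ≤ √2 := le_sqrt_of_sq_le (by norm_num)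
    nlinarith
  have h₀ := integral_infDist_gridCenter_zero_le hμ hrot
  have h₁ := integral_infDist_gridCenter_one_le hμ
  have hle (i : Fin 7) (hi : 2 ≤ i) := integral_infDist_gridCenter_le_of_two_le hμ hrot hi
  simp only [tangentBound] at h₀ h₁
  rw [Fin.sum_univ_seven]
  linarith [hle 2 (by decide), hle 3 (by decide), hle 4 (by decide), hle 5 (by decide),
    hle 6 (by decide)]

theorem whp_not_achievesExactRecovery_gridCenter (hμ : IsUnitBallProbability μ)
    (hrot : IsRotationInvariant μ) (hsupp : Metric.ball 0 1 ⊆ μ.support)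
    (hmean : 199 / 200 ≤ ∫ v, ‖v‖ ∂μ) :
    WithHighProbability (fun n => sampleLaw μ 7 n)
      fun _ => {v | ¬ KMedian.AchievesExactRecovery (dataPoints gridCenter v)} := by
  refine whp_not_achievesExactRecovery hμ (hrot.integral_eq_zero_of_odd NormedSpace.normalize_neg)
    gridMedian_injective (fun j => ?_) (mod_cast sum_integral_infDist_gridCenter_lt hμ hrot hmean)
  obtain ⟨i, hi⟩ := exists_dist_gridMedian_gridCenter_lt j
  exact ⟨i, hsupp (by rwa [mem_ball_zero_iff, ← dist_eq_norm])⟩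

end Configuration

end SBM

theorem mainTheorem8 :
    ∃ (μ : Measure (EuclideanSpace ℝ (Fin 2))) (c : Fin 7 → EuclideanSpace ℝ (Fin 2)),
      SBM.IsUnitBallProbability μ ∧
      SBM.HasContinuousDensity μ ∧
      SBM.IsRotationInvariant μ ∧
      SBM.HasMassNearCenter μ ∧
      IsLeast {t : ℝ | ∃ i j : Fin 7, i ≠ j ∧ t = dist (c i) (c j)} (2.2 : ℝ) ∧
      SBM.WithHighProbability (fun n => SBM.sampleLaw μ 7 n)
        (fun n => {v : Fin 7 × Fin n → EuclideanSpace ℝ (Fin 2) |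
          ¬ KMedian.AchievesExactRecovery (SBM.dataPoints c v)}) := by
  refine ⟨SBM.radialMeasure 2 1000, SBM.gridCenter, SBM.isUnitBallProbability_radialMeasure 1000,
    SBM.hasContinuousDensity_radialMeasure 1000, SBM.isRotationInvariant_radialMeasure 1000,
    SBM.hasMassNearCenter_radialMeasure 1000, SBM.isLeast_dist_gridCenter,
    SBM.whp_not_achievesExactRecovery_gridCenter (SBM.isUnitBallProbability_radialMeasure 1000)
      (SBM.isRotationInvariant_radialMeasure 1000) (fun x hx => ?_) ?_⟩
  · exact SBM.mem_support_radialMeasure 1000 (mem_ball_zero_iff.1 hx)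
  · rw [SBM.integral_norm_radialMeasure]
    norm_num
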